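/- Fix a universe of "small" sets and let $\kappa$ and $\lambda$ be regular cardinals in it. Let $\mathcal{C}$, $\mathcal{D}$ and $\mathcal{E}$ be categories with colimits of small $\kappa$-filtered diagrams, and let $F : \mathcal{C} \to \mathcal{E}$ and $G : \mathcal{D} \to \mathcal{E}$ be functors that preserve colimits of small $\kappa$-filtered diagrams. Let $F \wr G$ be the iso-comma category, i.e. the full subcategory of the comma category $(F \downarrow G)$ spanned by the objects $(C, D, e)$ for which $e : F C \to G D$ is an isomorphism in $\mathcal{E}$. Let $P : F \wr G \to \mathcal{C}$ and $Q : F \wr G \to \mathcal{D}$ be the projections. An object $A$ of a category is $\lambda$-presentable if $\mathrm{Hom}(A, -)$ preserves colimits of small $\lambda$-filtered diagrams. A category is $\lambda$-accessible if it is locally small, has colimits of small $\lambda$-filtered diagrams, and has an (essentially) small family of $\lambda$-presentable objects such that every object is the colimit of a small $\lambda$-filtered diagram with vertices in that family. A functor is strongly $\lambda$-accessible if its source and target are $\lambda$-accessible categories, it preserves colimits of small $\lambda$-filtered diagrams, and it sends $\lambda$-presentable objects to $\lambda$-presentable objects. Then: (i) $F \wr G$ has colimits of small $\kappa$-filtered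 diagrams, and they are created by the projection $\langle P, Q\rangle : F \wr G \to \mathcal{C} \times \mathcal{D}$ (for each such diagram $X$ in $F \wr G$, every colimiting cocone on the image of $X$ is, up to isomorphism, the image of a cocone on $X$, and every cocone on $X$ whose image is colimiting is itself colimiting). (ii) Suppose $\kappa \le \lambda$, and let $(C, D, e)$ be an object of $F \wr G$. If $C$ is $\lambda$-presentable in $\mathcal{C}$, $D$ is $\lambda$-presentable in $\mathcal{D}$, and $F C$ is $\lambda$-presentable in $\mathcal{E}$, then $(C, D, e)$ is $\lambda$-presentable in $F \wr G$. (iii) If $F$ and $G$ are strongly $\lambda$-accessible functors and $\kappa < \lambda$, then $F \wr G$ is a $\lambda$-accessible category, and the projection functors $P : F \wr G \to \mathcal{C}$ and $Q : F \wr G \to \mathcal{D}$ are strongly $\lambda$-accessible. -/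

import Mathlib

open CategoryTheory CategoryTheory.Limits

universe w v₁ v₂ v₃ u₁ u₂ u₃

namespace CategoryTheory

section IsoComma

variable {C : Type u₁} [Category.{v₁} C] {D : Type u₂} [Category.{v₂} D]
  {E : Type u₃} [Category.{v₃} E] (F : C ⥤ E) (G : D ⥤ E)

/-- The property of an object `(c, d, e : F c ⟶ G d)` of the comma category that `e` is an
isomorphism. -/
def isoCommaProperty : ObjectProperty (Comma F G) :=
  fun X => IsIso X.hom

/-- The iso-comma category of `F` and `G`: the full subcategory of the comma category spanned by
the objects `(c, d, e)` where `e : F c ⟶ G d` is an isomorphism. -/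
abbrev IsoComma : Type (max u₁ u₂ v₃) :=
  (isoCommaProperty F G).FullSubcategory

namespace IsoComma

/-- The projection from the iso-comma category to `C`. -/
abbrev fst : IsoComma F G ⥤ C :=
  (isoCommaProperty F G).ι ⋙ Comma.fst F G

/-- The projection from the iso-comma category to `D`. -/
abbrev snd : IsoComma F G ⥤ D :=
  (isoCommaProperty F G).ι ⋙ Comma.snd F G

/-- The projection from the iso-comma category to `C × D`. -/
abbrev proj : IsoComma F G ⥤ C × D :=
  (fst F G).prod' (snd F G)

end IsoComma

end IsoComma

/-- A functor is strongly `κ`-accessible if its source and its target are `κ`-accessible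
categories, it preserves colimits of small `κ`-filtered diagrams, and it sends `κ`-presentable
objects to `κ`-presentable objects. Smallness is relative to the universe `w`. -/
structure Functor.IsStronglyCardinalAccessible {C : Type u₁} [Category.{v₁} C]
    {D : Type u₂} [Category.{v₂} D] (F : C ⥤ D) (κ : Cardinal.{w}) [Fact κ.IsRegular] :
    Prop where
  source_accessible : IsCardinalAccessibleCategory C κ
  target_accessible : IsCardinalAccessibleCategory D κ
  preserves_colimits : F.IsCardinalAccessible κ
  preserves_presentable : ∀ X : C, IsCardinalPresentable X κ → IsCardinalPresentable (F.obj X) κ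

end CategoryTheory

/-! For (i), take colimits of both projections of a diagram. As `F` and `G` preserve them, the
structure isomorphisms induce an isomorphism between their images in `E`, which is the structure map
of the colimit. For (ii), the two components of a map into a colimit factor through some stages; the
resulting square commutes in the colimit, hence at a later stage, because `F c` is presentable and
`G` preserves the colimit.

The substance of (iii) is that enough objects have presentable components. Write the components of
an object `W` as colimits of presentable objects `x p`, `y p` over one `lam`-directed poset. Then `F
(x p)` and `G (y p)` are diagrams of presentable objects with isomorphic colimits. The isomorphism
and its inverse give maps between stages of the two diagrams, natural and mutually inverse only
after passing to later stages. A chain of length `κ` can absorb all these delays, so along it the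
diagrams are interleaved and have isomorphic colimits (`exists_chain_iso`). Since `κ` is regular,
`F` and `G` preserve the colimits of the chain in `C` and `D`; since `κ < lam`, these colimits are
still `lam`-presentable. They form an object over `W` through which a prescribed stage factors
(`exists_hom_of_colimitPresentation`).

Consequently the category of objects over `W` with presentable components is `lam`-filtered and
projects finally onto the canonical diagrams of both components of `W`. Density in `C` and `D` then
exhibits `W` as a colimit (`isCardinalFilteredGenerator`). Presentable objects are retracts of
members of this generator, so the projections preserve presentability. -/

namespace CategoryTheory

/-! ### Colimits in a product of two categories -/

section Product

variable {C : Type u₁} [Category.{v₁} C] {D : Type u₂} [Category.{v₂} D]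
  {J : Type u₃} [Category.{v₃} J]

/-- A cocone in a product category is colimiting when both of its components are. -/
def Limits.isColimitOfFstSnd {K : J ⥤ C × D} {c : Cocone K}
    (h₁ : IsColimit ((Prod.fst C D).mapCocone c)) (h₂ : IsColimit ((Prod.snd C D).mapCocone c)) :
    IsColimit c where
  desc s := (h₁.desc ((Prod.fst C D).mapCocone s), h₂.desc ((Prod.snd C D).mapCocone s))
  fac s j := Prod.ext (h₁.fac ((Prod.fst C D).mapCocone s) j)
    (h₂.fac ((Prod.snd C D).mapCocone s) j)
  uniq s m hm := Prod.ext
    (h₁.uniq ((Prod.fst C D).mapCocone s) m.1 (fun j => congrArg (fun f => f.1) (hm j)))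
    (h₂.uniq ((Prod.snd C D).mapCocone s) m.2 (fun j => congrArg (fun f => f.2) (hm j)))

/-- The cocone in a product category with given components. -/
def Limits.prodCocone {K : J ⥤ C × D} (c₁ : Cocone (K ⋙ Prod.fst C D))
    (c₂ : Cocone (K ⋙ Prod.snd C D)) : Cocone K where
  pt := (c₁.pt, c₂.pt)
  ι :=
    { app j := (c₁.ι.app j, c₂.ι.app j)
      naturality _ _ f := Prod.ext (c₁.ι.naturality f) (c₂.ι.naturality f) }

instance (K : J ⥤ C × D) [HasColimit (K ⋙ Prod.fst C D)] [HasColimit (K ⋙ Prod.snd C D)] :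
    HasColimit K :=
  ⟨⟨_, isColimitOfFstSnd (c := prodCocone _ _) (colimit.isColimit (K ⋙ Prod.fst C D))
    (colimit.isColimit (K ⋙ Prod.snd C D))⟩⟩

instance [HasColimitsOfShape J C] [HasColimitsOfShape J D] :
    HasColimitsOfShape J (C × D) where

instance (K : J ⥤ C × D) [HasColimit (K ⋙ Prod.fst C D)] [HasColimit (K ⋙ Prod.snd C D)] :
    PreservesColimit K (Prod.fst C D) :=
  preservesColimit_of_preserves_colimit_cocone
    (isColimitOfFstSnd (c := prodCocone _ _) (colimit.isColimit (K ⋙ Prod.fst C D))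
      (colimit.isColimit (K ⋙ Prod.snd C D))) (colimit.isColimit (K ⋙ Prod.fst C D))

instance (K : J ⥤ C × D) [HasColimit (K ⋙ Prod.fst C D)] [HasColimit (K ⋙ Prod.snd C D)] :
    PreservesColimit K (Prod.snd C D) :=
  preservesColimit_of_preserves_colimit_cocone
    (isColimitOfFstSnd (c := prodCocone _ _) (colimit.isColimit (K ⋙ Prod.fst C D))
      (colimit.isColimit (K ⋙ Prod.snd C D))) (colimit.isColimit (K ⋙ Prod.snd C D))

end Product

/-! ### Creation of colimits and presentable objects in the iso-comma category -/

namespace IsoComma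

variable {C : Type u₁} [Category.{v₁} C] {D : Type u₂} [Category.{v₂} D]
  {E : Type u₃} [Category.{v₃} E] {F : C ⥤ E} {G : D ⥤ E}

/-- The structure isomorphism of an object of the iso-comma category. -/
noncomputable def iso (X : IsoComma F G) : F.obj X.obj.left ≅ G.obj X.obj.right :=
  have : IsIso X.obj.hom := X.property
  asIso X.obj.hom

@[simp]
lemma iso_hom (X : IsoComma F G) : (iso X).hom = X.obj.hom := rfl

/-- Constructor for objects of the iso-comma category. -/
@[simps]
def mk {c : C} {d : D} (e : F.obj c ≅ G.obj d) : IsoComma F G :=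
  ⟨{ left := c, right := d, hom := e.hom }, inferInstanceAs (IsIso e.hom)⟩

/-- Constructor for morphisms of the iso-comma category. -/
@[simps!]
def homMk {X Y : IsoComma F G} (a : X.obj.left ⟶ Y.obj.left) (b : X.obj.right ⟶ Y.obj.right)
    (w : F.map a ≫ Y.obj.hom = X.obj.hom ≫ G.map b) : X ⟶ Y :=
  ObjectProperty.homMk { left := a, right := b, w := w }

@[ext]
lemma hom_ext {X Y : IsoComma F G} {f g : X ⟶ Y} (h₁ : f.hom.left = g.hom.left)
    (h₂ : f.hom.right = g.hom.right) : f = g :=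
  ObjectProperty.hom_ext _ (CommaMorphism.ext h₁ h₂)

/-- Constructor for isomorphisms of the iso-comma category. -/
@[simps]
def isoMk {X Y : IsoComma F G} (a : X.obj.left ≅ Y.obj.left) (b : X.obj.right ≅ Y.obj.right)
    (w : F.map a.hom ≫ Y.obj.hom = X.obj.hom ≫ G.map b.hom) : X ≅ Y where
  hom := homMk a.hom b.hom w
  inv := homMk a.inv b.inv (by
    rw [← cancel_epi (F.map a.hom), ← Functor.map_comp_assoc, reassoc_of% w,
      ← Functor.map_comp]
    simp)

instance : (proj F G).ReflectsIsomorphisms where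
  reflects {X Y} f hf := by
    have h₁ : IsIso f.hom.left := inferInstanceAs (IsIso ((Prod.fst C D).map ((proj F G).map f)))
    have h₂ : IsIso f.hom.right := inferInstanceAs (IsIso ((Prod.snd C D).map ((proj F G).map f)))
    exact (isoMk (asIso f.hom.left) (asIso f.hom.right) f.hom.w).isIso_hom

variable {J : Type*} [Category* J]

/-- The two projections from the iso-comma category jointly reflect the colimits which are
preserved by `F`. -/
noncomputable def isColimitOfFstSnd {K : J ⥤ IsoComma F G} {c : Cocone K}
    [PreservesColimit (K ⋙ fst F G) F]
    (h₁ : IsColimit ((fst F G).mapCocone c)) (h₂ : IsColimit ((snd F G).mapCocone c)) :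
    IsColimit c :=
  have : PreservesColimit ((K ⋙ (isoCommaProperty F G).ι) ⋙ Comma.fst F G) F :=
    inferInstanceAs (PreservesColimit (K ⋙ fst F G) F)
  isColimitOfReflects (isoCommaProperty F G).ι
    (Comma.fstSndJointlyReflectColimit (c := (isoCommaProperty F G).ι.mapCocone c) h₁ h₂)

/-- The natural isomorphism between the two composites to `E`. -/
noncomputable def natIso : fst F G ⋙ F ≅ snd F G ⋙ G :=
  NatIso.ofComponents iso (fun f => f.hom.w)

/-- A cocone on a diagram in the iso-comma category, built from colimiting cocones on its
projections which are preserved by `F` and `G`. -/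
noncomputable def coconeOfIsColimit (K : J ⥤ IsoComma F G) [PreservesColimit (K ⋙ fst F G) F]
    [PreservesColimit (K ⋙ snd F G) G] {c₁ : Cocone (K ⋙ fst F G)} (h₁ : IsColimit c₁)
    {c₂ : Cocone (K ⋙ snd F G)} (h₂ : IsColimit c₂) : Cocone K where
  pt := mk (IsColimit.coconePointsIsoOfNatIso (isColimitOfPreserves F h₁)
    (isColimitOfPreserves G h₂) (Functor.isoWhiskerLeft K natIso))
  ι :=
    { app j := homMk (c₁.ι.app j) (c₂.ι.app j)
        (IsColimit.comp_coconePointsIsoOfNatIso_hom (isColimitOfPreserves F h₁)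
          (isColimitOfPreserves G h₂) (Functor.isoWhiskerLeft K natIso) j)
      naturality _ _ f := by
        ext
        · exact c₁.ι.naturality f
        · exact c₂.ι.naturality f }

/-- The projection from the iso-comma category to the product creates the colimits which are
preserved by `F` and `G`. -/
noncomputable abbrev createsColimitProj (K : J ⥤ IsoComma F G)
    [HasColimit (K ⋙ fst F G)] [HasColimit (K ⋙ snd F G)]
    [PreservesColimit (K ⋙ fst F G) F] [PreservesColimit (K ⋙ snd F G) G] :
    CreatesColimit K (proj F G) :=
  -- Since `proj` reflects isomorphisms, it suffices to lift each colimiting cocone to one that is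
  -- itself colimiting.
  createsColimitOfReflectsIso (fun c hc =>
    have : HasColimit ((K ⋙ proj F G) ⋙ Prod.fst C D) :=
      inferInstanceAs (HasColimit (K ⋙ fst F G))
    have : HasColimit ((K ⋙ proj F G) ⋙ Prod.snd C D) :=
      inferInstanceAs (HasColimit (K ⋙ snd F G))
    let h₁ : IsColimit (F := K ⋙ fst F G) ((Prod.fst C D).mapCocone c) :=
      isColimitOfPreserves (Prod.fst C D) hc
    let h₂ : IsColimit (F := K ⋙ snd F G) ((Prod.snd C D).mapCocone c) :=
      isColimitOfPreserves (Prod.snd C D) hc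
    { liftedCocone := coconeOfIsColimit K h₁ h₂
      validLift := Cocone.ext (Iso.refl _) (fun _ => Category.comp_id _)
      makesColimit := isColimitOfFstSnd h₁ h₂ })

variable (κ : Cardinal.{w}) [Fact κ.IsRegular]
  [HasCardinalFilteredColimits C κ] [HasCardinalFilteredColimits D κ]
  [F.IsCardinalAccessible κ] [G.IsCardinalAccessible κ]

variable (F G) in
/-- The projection from the iso-comma category to the product creates `κ`-filtered colimits. -/
noncomputable abbrev createsColimitsOfShapeProj (J : Type w) [SmallCategory J]
    [IsCardinalFiltered J κ] : CreatesColimitsOfShape J (proj F G) where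
  CreatesColimit {K} :=
    have := HasCardinalFilteredColimits.hasColimitsOfShape (κ := κ) C J
    have := HasCardinalFilteredColimits.hasColimitsOfShape (κ := κ) D J
    have := F.preservesColimitsOfShape_of_isCardinalAccessible κ J
    have := G.preservesColimitsOfShape_of_isCardinalAccessible κ J
    createsColimitProj K

variable (F G) in
lemma hasCardinalFilteredColimits : HasCardinalFilteredColimits (IsoComma F G) κ where
  hasColimitsOfShape J := by
    intros
    have := HasCardinalFilteredColimits.hasColimitsOfShape (κ := κ) C J
    have := HasCardinalFilteredColimits.hasColimitsOfShape (κ := κ) D J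
    have := createsColimitsOfShapeProj F G κ J
    exact hasColimitsOfShape_of_hasColimitsOfShape_createsColimitsOfShape (proj F G)

/-- A functor creating colimits preserves those that exist in its target; the product projection
preserves them as well. -/
lemma isCardinalAccessible_fst : (fst F G).IsCardinalAccessible κ where
  preservesColimitOfShape J _ _ := by
    have := HasCardinalFilteredColimits.hasColimitsOfShape (κ := κ) C J
    have := HasCardinalFilteredColimits.hasColimitsOfShape (κ := κ) D J
    have := createsColimitsOfShapeProj F G κ J
    have : PreservesColimitsOfShape J (Prod.fst C D) := { }
    exact inferInstanceAs (PreservesColimitsOfShape J (proj F G ⋙ Prod.fst C D))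

lemma isCardinalAccessible_snd : (snd F G).IsCardinalAccessible κ where
  preservesColimitOfShape J _ _ := by
    have := HasCardinalFilteredColimits.hasColimitsOfShape (κ := κ) C J
    have := HasCardinalFilteredColimits.hasColimitsOfShape (κ := κ) D J
    have := createsColimitsOfShapeProj F G κ J
    have : PreservesColimitsOfShape J (Prod.snd C D) := { }
    exact inferInstanceAs (PreservesColimitsOfShape J (proj F G ⋙ Prod.snd C D))

/-- An object `(c, d, e)` of the iso-comma category is presentable when `c`, `d` and `F c` are. -/
lemma isCardinalPresentable {lam : Cardinal.{w}} [Fact lam.IsRegular] (h : κ ≤ lam)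
    (X : IsoComma F G) [IsCardinalPresentable X.obj.left lam]
    [IsCardinalPresentable X.obj.right lam] [IsCardinalPresentable (F.obj X.obj.left) lam] :
    IsCardinalPresentable X lam where
  preservesColimitOfShape J _ _ := ⟨fun {K} => ⟨fun {c} hc => ⟨by
    have := IsCardinalFiltered.of_le J h
    have := isFiltered_of_isCardinalFiltered J κ
    have := essentiallySmallSelf J
    have := (isCardinalAccessible_fst (F := F) (G := G) κ).preservesColimitOfShape J
    have := (isCardinalAccessible_snd (F := F) (G := G) κ).preservesColimitOfShape J
    have := G.preservesColimitsOfShape_of_isCardinalAccessible κ J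
    have h₁ := isColimitOfPreserves (fst F G) hc
    have h₂ := isColimitOfPreserves (snd F G) hc
    have h₃ := isColimitOfPreserves G h₂
    -- A filtered cocone of types is colimiting when every element comes from some stage and two
    -- elements of a stage with the same image agree later.
    refine Types.FilteredColimit.isColimitOf' _ _ (fun (f : X ⟶ c.pt) => ?_)
      (fun j (f₁ : X ⟶ K.obj j) (f₂ : X ⟶ K.obj j) hf => ?_)
    · obtain ⟨j₁, (a : X.obj.left ⟶ (K.obj j₁).obj.left),
          (ha : a ≫ (c.ι.app j₁).hom.left = f.hom.left)⟩ :=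
        IsCardinalPresentable.exists_hom_of_isColimit lam h₁ f.hom.left
      obtain ⟨j₂, (b : X.obj.right ⟶ (K.obj j₂).obj.right),
          (hb : b ≫ (c.ι.app j₂).hom.right = f.hom.right)⟩ :=
        IsCardinalPresentable.exists_hom_of_isColimit lam h₂ f.hom.right
      have h₄ := f.hom.w
      have h₅ := (c.ι.app j₁).hom.w
      -- The square formed by `a` and `b` commutes only in the colimit of the `G`-images.
      -- Presentability of `F.obj X.obj.left` makes it commute at a stage `k`.
      obtain ⟨k, u, v, (huv : (F.map a ≫ (K.obj j₁).obj.hom) ≫ G.map (K.map u).hom.right =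
          (X.obj.hom ≫ G.map b) ≫ G.map (K.map v).hom.right)⟩ :=
        IsCardinalPresentable.exists_eq_of_isColimit lam h₃
          (i₁ := j₁) (i₂ := j₂) (F.map a ≫ (K.obj j₁).obj.hom) (X.obj.hom ≫ G.map b) (by
            change (F.map a ≫ (K.obj j₁).obj.hom) ≫ G.map (c.ι.app j₁).hom.right =
              (X.obj.hom ≫ G.map b) ≫ G.map (c.ι.app j₂).hom.right
            dsimp at h₄ h₅
            rw [Category.assoc, Category.assoc, ← h₅, ← Functor.map_comp, hb,
              ← Functor.map_comp_assoc, ha, h₄])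
      refine ⟨k, homMk (a ≫ (K.map u).hom.left) (b ≫ (K.map v).hom.right) ?_, ?_⟩
      · have h₆ := (K.map u).hom.w
        dsimp at h₆ ⊢
        rw [Functor.map_comp, Category.assoc, h₆, Functor.map_comp]
        simpa using huv
      · change f = homMk _ _ _ ≫ c.ι.app k
        symm
        ext
        · exact (Category.assoc _ _ _).trans (Eq.trans
            (congrArg (fun g : K.obj j₁ ⟶ c.pt => a ≫ g.hom.left) (c.w u)) ha)
        · exact (Category.assoc _ _ _).trans (Eq.trans
            (congrArg (fun g : K.obj j₂ ⟶ c.pt => b ≫ g.hom.right) (c.w v)) hb)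
    · have hf' : f₁ ≫ c.ι.app j = f₂ ≫ c.ι.app j := hf
      obtain ⟨k₁, u₁, (hu₁ : f₁.hom.left ≫ (K.map u₁).hom.left =
          f₂.hom.left ≫ (K.map u₁).hom.left)⟩ :=
        IsCardinalPresentable.exists_eq_of_isColimit' lam h₁
          f₁.hom.left f₂.hom.left (congrArg (fun f => f.hom.left) hf')
      obtain ⟨k₂, u₂, (hu₂ : f₁.hom.right ≫ (K.map u₂).hom.right =
          f₂.hom.right ≫ (K.map u₂).hom.right)⟩ :=
        IsCardinalPresentable.exists_eq_of_isColimit' lam h₂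
          f₁.hom.right f₂.hom.right (congrArg (fun f => f.hom.right) hf')
      obtain ⟨l, v₁, v₂, hv⟩ := IsFiltered.span u₁ u₂
      refine ⟨l, u₁ ≫ v₁, ?_⟩
      change f₁ ≫ K.map (u₁ ≫ v₁) = f₂ ≫ K.map (u₁ ≫ v₁)
      ext
      · simp [reassoc_of% hu₁]
      · simp [hv, reassoc_of% hu₂]⟩⟩⟩

end IsoComma

/-! ### Colimits of interleaved sequences -/

section Interleaving

variable {E : Type u₃} [Category.{v₃} E] {K : Type*} [LinearOrder K] [NoMaxOrder K]
  {X Y : K ⥤ E}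

/-- A family of morphisms `X i ⟶ Y j` for `i < j`, compatible with the transition morphisms,
induces a morphism between colimits. -/
lemma Limits.IsColimit.exists_desc_of_lt {s : Cocone X} (hs : IsColimit s) (t : Cocone Y)
    (u : ∀ i j, i < j → (X.obj i ⟶ Y.obj j))
    (hu₁ : ∀ i j k (hij : i < j) (hjk : j < k),
      X.map (homOfLE hij.le) ≫ u j k hjk = u i k (hij.trans hjk))
    (hu₂ : ∀ i j k (hij : i < j) (hjk : j ≤ k),
      u i j hij ≫ Y.map (homOfLE hjk) = u i k (hij.trans_le hjk)) :
    ∃ U : s.pt ⟶ t.pt, ∀ i j (hij : i < j), s.ι.app i ≫ U = u i j hij ≫ t.ι.app j := by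
  -- The component at `i` does not depend on the index `j > i` used to define it.
  have key (i j k) (hij : i < j) (hik : i < k) :
      u i j hij ≫ t.ι.app j = u i k hik ≫ t.ι.app k := by
    wlog h : j ≤ k generalizing j k
    · exact (this k j hik hij (le_of_not_ge h)).symm
    · rw [← hu₂ i j k hij h, Category.assoc, t.w]
  choose σ hσ using fun i : K => exists_gt i
  let c : Cocone X :=
    { pt := t.pt
      ι :=
        { app i := u i (σ i) (hσ i) ≫ t.ι.app (σ i)
          naturality i j f := by
            -- `hu₁` covers only strict inequalities, so identity arrows are treated separately.
            obtain hij | rfl := (leOfHom f).lt_or_eq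
            · rw [key i (σ i) (σ j) _ (hij.trans (hσ j)), ← hu₁ i j (σ j) hij (hσ j)]
              simp [Subsingleton.elim f (homOfLE hij.le)]
            · simp [Subsingleton.elim f (𝟙 _)] } }
  exact ⟨hs.desc c, fun i j hij => (hs.fac c i).trans (key i _ _ _ _)⟩

/-- Interleaved sequences have isomorphic colimits. -/
lemma Limits.IsColimit.exists_iso_of_lt {s : Cocone X} (hs : IsColimit s) {t : Cocone Y}
    (ht : IsColimit t) (u : ∀ i j, i < j → (X.obj i ⟶ Y.obj j))
    (v : ∀ i j, i < j → (Y.obj i ⟶ X.obj j))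
    (hu₁ : ∀ i j k (hij : i < j) (hjk : j < k),
      X.map (homOfLE hij.le) ≫ u j k hjk = u i k (hij.trans hjk))
    (hu₂ : ∀ i j k (hij : i < j) (hjk : j ≤ k),
      u i j hij ≫ Y.map (homOfLE hjk) = u i k (hij.trans_le hjk))
    (hv₁ : ∀ i j k (hij : i < j) (hjk : j < k),
      Y.map (homOfLE hij.le) ≫ v j k hjk = v i k (hij.trans hjk))
    (hv₂ : ∀ i j k (hij : i < j) (hjk : j ≤ k),
      v i j hij ≫ X.map (homOfLE hjk) = v i k (hij.trans_le hjk))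
    (huv : ∀ i j k (hij : i < j) (hjk : j < k),
      u i j hij ≫ v j k hjk = X.map (homOfLE (hij.trans hjk).le))
    (hvu : ∀ i j k (hij : i < j) (hjk : j < k),
      v i j hij ≫ u j k hjk = Y.map (homOfLE (hij.trans hjk).le)) :
    ∃ θ : s.pt ≅ t.pt, ∀ i j (hij : i < j), s.ι.app i ≫ θ.hom = u i j hij ≫ t.ι.app j := by
  obtain ⟨U, hU⟩ := hs.exists_desc_of_lt t u hu₁ hu₂
  obtain ⟨V, hV⟩ := ht.exists_desc_of_lt s v hv₁ hv₂
  refine ⟨⟨U, V, hs.hom_ext fun i => ?_, ht.hom_ext fun i => ?_⟩, hU⟩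
  · obtain ⟨j, hij⟩ := exists_gt i
    obtain ⟨k, hjk⟩ := exists_gt j
    rw [reassoc_of% hU i j hij, hV j k hjk, reassoc_of% huv i j k hij hjk]
    simp
  · obtain ⟨j, hij⟩ := exists_gt i
    obtain ⟨k, hjk⟩ := exists_gt j
    rw [reassoc_of% hV i j hij, hU j k hjk, reassoc_of% hvu i j k hij hjk]
    simp

end Interleaving

/-! ### Chains in directed posets -/

section Chain

lemma hasCardinalLT_ord_toType {κ lam : Cardinal.{w}} (h : κ < lam) :
    HasCardinalLT κ.ord.ToType lam := by
  rw [hasCardinalLT_iff_cardinal_mk_lt, Cardinal.mk_ord_toType]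
  exact h

variable {P : Type w} [PartialOrder P] {κ lam : Cardinal.{w}}
  [Fact lam.IsRegular] [IsCardinalFiltered P lam]

lemma IsCardinalFiltered.exists_upperBound {ι : Type*} (S : ι → P) (hι : HasCardinalLT ι lam) :
    ∃ p, ∀ i, S i ≤ p :=
  ⟨IsCardinalFiltered.max S hι, fun i => leOfHom (IsCardinalFiltered.toMax S hι i)⟩

/-- In a `lam`-directed poset, there are `κ`-chains closed under any given binary operation. -/
lemma IsCardinalFiltered.exists_chain (h : κ < lam) (p : P) (N : P → P → P)
    (hN : ∀ q r, q ≤ N q r) :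
    ∃ f : κ.ord.ToType → P, Monotone f ∧ (∀ i, p ≤ f i) ∧
      ∀ i j k, i < k → j < k → N (f i) (f j) ≤ f k := by
  have hlam : Cardinal.aleph0 ≤ lam := (Fact.out : lam.IsRegular).aleph0_le
  have hI (k : κ.ord.ToType) : HasCardinalLT (Option (Set.Iio k × Set.Iio k)) lam := by
    rw [hasCardinalLT_option_iff _ _ hlam]
    have : HasCardinalLT (Set.Iio k) lam :=
      (hasCardinalLT_ord_toType h).of_injective _ Subtype.val_injective
    exact hasCardinalLT_prod hlam this this
  -- What the term at `k` must dominate: the base point `p` (`none`) and `N` of each pair of earlier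
  -- terms (`some`).
  let S (k : κ.ord.ToType) (g : ∀ i, i < k → P) : Option (Set.Iio k × Set.Iio k) → P :=
    fun x => x.elim p (fun y => N (g y.1.1 y.1.2) (g y.2.1 y.2.2))
  choose b hb using fun k g => IsCardinalFiltered.exists_upperBound (S k g) (hI k)
  let f : κ.ord.ToType → P := WellFoundedLT.fix b
  have hf (k) : f k = b k (fun i _ => f i) := WellFoundedLT.fix_eq _ _
  have h₁ (i j k) (hi : i < k) (hj : j < k) : N (f i) (f j) ≤ f k := by
    rw [hf k]
    exact hb k (fun i _ => f i) (some (⟨i, hi⟩, ⟨j, hj⟩))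
  refine ⟨f, fun i k hik => ?_, fun k => ?_, h₁⟩
  · obtain hik | rfl := hik.lt_or_eq
    · exact (hN _ _).trans (h₁ i i k hik hik)
    · rfl
  · rw [hf k]
    exact hb k (fun i _ => f i) none

end Chain

/-! ### Chains along which two directed diagrams have isomorphic colimits -/

section

open Filter

variable {E : Type u₃} [Category.{v₃} E] {P : Type w} [PartialOrder P]
  {κ lam : Cardinal.{w}} [Fact κ.IsRegular] [Fact lam.IsRegular] [IsCardinalFiltered P lam]

variable (lam) in
/-- Two morphisms from a presentable object to terms of a directed diagram, which agree in the
colimit, agree at all sufficiently large stages. -/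
lemma IsCardinalPresentable.eventually_eq {Y : P ⥤ E} {c : Cocone Y} (hc : IsColimit c) {A : E}
    [IsCardinalPresentable A lam] {q r : P} (α : A ⟶ Y.obj q) (β : A ⟶ Y.obj r)
    (h : α ≫ c.ι.app q = β ≫ c.ι.app r) :
    ∀ᶠ n in atTop, ∀ (hq : q ≤ n) (hr : r ≤ n),
      α ≫ Y.map (homOfLE hq) = β ≫ Y.map (homOfLE hr) := by
  have := essentiallySmallSelf P
  obtain ⟨m, a, b, hm⟩ := IsCardinalPresentable.exists_eq_of_isColimit lam hc α β h
  filter_upwards [eventually_ge_atTop m] with n hn hq hr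
  rw [← homOfLE_comp (leOfHom a) hn, ← homOfLE_comp (leOfHom b) hn, Functor.map_comp,
    Functor.map_comp, ← Category.assoc, ← Category.assoc]
  exact hm =≫ Y.map (homOfLE hn)

variable {X Y : P ⥤ E} {c : Cocone X} {d : Cocone Y} (hc : IsColimit c) (hd : IsColimit d)

-- Each `X.obj q` is presentable, so its map to `d.pt` factors through a stage. The choices for
-- different `q` are unrelated, and naturality has to be recovered later.
variable (lam) in
include hd in
lemma IsCardinalPresentable.exists_hom_of_directed (e : c.pt ≅ d.pt)
    [∀ q, IsCardinalPresentable (X.obj q) lam] :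
    ∃ (φ : P → P) (u : ∀ q, X.obj q ⟶ Y.obj (φ q)),
      ∀ q, u q ≫ d.ι.app (φ q) = c.ι.app q ≫ e.hom := by
  have := essentiallySmallSelf P
  choose φ u hu using fun q =>
    IsCardinalPresentable.exists_hom_of_isColimit lam hd (c.ι.app q ≫ e.hom)
  exact ⟨φ, u, hu⟩

-- Both sides agree in `d.pt`. The order hypotheses sit under the filter, so that a threshold exists
-- for every pair `q`, `r`, vacuously when `q ≤ r` fails.
variable (lam) in
include hd in
lemma IsCardinalPresentable.eventually_square (e : c.pt ≅ d.pt)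
    [∀ q, IsCardinalPresentable (X.obj q) lam] {φ : P → P} (u : ∀ q, X.obj q ⟶ Y.obj (φ q))
    (hu : ∀ q, u q ≫ d.ι.app (φ q) = c.ι.app q ≫ e.hom) (q r : P) :
    ∀ᶠ n in atTop, ∀ (h : q ≤ r) (h₁ : φ r ≤ n) (h₂ : φ q ≤ n),
      X.map (homOfLE h) ≫ u r ≫ Y.map (homOfLE h₁) = u q ≫ Y.map (homOfLE h₂) := by
  by_cases h : q ≤ r
  · filter_upwards [IsCardinalPresentable.eventually_eq lam hd (X.map (homOfLE h) ≫ u r) (u q)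
      (by simp [hu])] with n hn _ h₁ h₂
    simpa using hn h₁ h₂
  · exact Eventually.of_forall fun n h' => (h h').elim

-- A round trip through `Y` is the identity in `c.pt`, since `e.hom` and `e.inv` cancel there, hence
-- becomes a transition map at a later stage.
variable (lam) in
include hc in
lemma IsCardinalPresentable.eventually_triangle (e : c.pt ≅ d.pt)
    [∀ q, IsCardinalPresentable (X.obj q) lam] {φ ψ : P → P} (u : ∀ q, X.obj q ⟶ Y.obj (φ q))
    (hu : ∀ q, u q ≫ d.ι.app (φ q) = c.ι.app q ≫ e.hom) (v : ∀ q, Y.obj q ⟶ X.obj (ψ q))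
    (hv : ∀ q, v q ≫ c.ι.app (ψ q) = d.ι.app q ≫ e.inv) (q r : P) :
    ∀ᶠ n in atTop, ∀ (h : φ q ≤ r) (h₁ : ψ r ≤ n) (h₂ : q ≤ n),
      u q ≫ Y.map (homOfLE h) ≫ v r ≫ X.map (homOfLE h₁) = X.map (homOfLE h₂) := by
  by_cases h : φ q ≤ r
  · filter_upwards [IsCardinalPresentable.eventually_eq lam hc
      (u q ≫ Y.map (homOfLE h) ≫ v r) (𝟙 (X.obj q))
      (by simp [hv, reassoc_of% hu])] with n hn _ h₁ h₂
    simpa using hn h₁ h₂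
  · exact Eventually.of_forall fun n h' => (h h').elim

variable (lam) in
include hc hd in
/-- Consider two `lam`-directed diagrams of `lam`-presentable objects with isomorphic colimits.
If `κ < lam`, then there are `κ`-chains of indices along which the colimits of both diagrams are
already isomorphic. -/
lemma IsCardinalPresentable.exists_chain_iso (h : κ < lam) (e : c.pt ≅ d.pt)
    [∀ q, IsCardinalPresentable (X.obj q) lam] [∀ q, IsCardinalPresentable (Y.obj q) lam]
    {ι : Type*} (hι : HasCardinalLT ι lam) {A : ι → E} [∀ k, IsCardinalPresentable (A k) lam]
    {p : P} (a : ∀ k, A k ⟶ X.obj p) (b : ∀ k, A k ⟶ Y.obj p)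
    (hab : ∀ k, a k ≫ c.ι.app p ≫ e.hom = b k ≫ d.ι.app p) :
    ∃ (f : κ.ord.ToType ⥤ P) (hf : ∀ i, p ≤ f.obj i), ∀ (s : Cocone (f ⋙ X)) (hs : IsColimit s)
      (t : Cocone (f ⋙ Y)) (ht : IsColimit t), ∃ θ : s.pt ≅ t.pt,
        θ.hom ≫ ht.desc (d.whisker f) = hs.desc (c.whisker f) ≫ e.hom ∧
        ∀ k i, a k ≫ X.map (homOfLE (hf i)) ≫ s.ι.app i ≫ θ.hom =
          b k ≫ Y.map (homOfLE (hf i)) ≫ t.ι.app i := by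
  have := isFiltered_of_isCardinalFiltered P lam
  have : IsDirectedOrder P := IsFiltered.isDirectedOrder P
  have : Nonempty P := ⟨p⟩
  have : NoMaxOrder κ.ord.ToType :=
    Cardinal.noMaxOrder (Cardinal.IsRegular.aleph0_le Fact.out)
  obtain ⟨φ, u, hu⟩ := exists_hom_of_directed lam (X := X) hd e
  obtain ⟨ψ, v, hv⟩ := exists_hom_of_directed lam (X := Y) hc e.symm
  -- The thresholds for the individual `k` have a common bound because `ι` has fewer than `lam`
  -- elements.
  have hab' (q : P) : ∀ᶠ n in atTop, ∀ (k : ι) (h : p ≤ q) (h₁ : φ q ≤ n) (h₂ : p ≤ n),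
      a k ≫ X.map (homOfLE h) ≫ u q ≫ Y.map (homOfLE h₁) = b k ≫ Y.map (homOfLE h₂) := by
    by_cases hq : p ≤ q
    · have H (k : ι) := eventually_atTop.1 (IsCardinalPresentable.eventually_eq lam hd
        (a k ≫ X.map (homOfLE hq) ≫ u q) (b k) (by simp [hu, hab]))
      choose m hm using H
      obtain ⟨n, hn⟩ := IsCardinalFiltered.exists_upperBound m hι
      filter_upwards [eventually_ge_atTop n] with n' hn' k _ h₁ h₂
      simpa using hm k n' ((hn k).trans hn') h₁ h₂
    · exact Eventually.of_forall fun n k h' => (hq h').elim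
  -- A single threshold `N q r` for both naturality squares, both round trips, compatibility with
  -- `a` and `b`, and the bounds by `q`, `φ q`, `ψ q`. A chain closed under `N` satisfies all of
  -- these at strictly later indices.
  have H (q r : P) := eventually_atTop.1 ((eventually_square lam hd e u hu q r).and
    ((eventually_square lam hc e.symm v hv q r).and
    ((eventually_triangle lam hc e u hu v hv q r).and
    ((eventually_triangle lam hd e.symm v hv u (by simpa using hu) q r).and
    ((hab' q).and ((eventually_ge_atTop q).and
    ((eventually_ge_atTop (φ q)).and (eventually_ge_atTop (ψ q)))))))))
  choose N hN using H
  obtain ⟨f, hf, hpf, hNf⟩ := IsCardinalFiltered.exists_chain (κ := κ) h p N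
    (fun q r => (hN q r _ le_rfl).2.2.2.2.2.1)
  have H (i j k) (hik : i < k) (hjk : j < k) := hN (f i) (f j) (f k) (hNf i j k hik hjk)
  have hφ (i j) (hij : i < j) : φ (f i) ≤ f j := (H i i j hij hij).2.2.2.2.2.2.1
  have hψ (i j) (hij : i < j) : ψ (f i) ≤ f j := (H i i j hij hij).2.2.2.2.2.2.2
  refine ⟨hf.functor, hpf, fun s hs t ht => ?_⟩
  -- The target `φ (f i)` of `u (f i)` is known to lie below `f j` only for `i < j`; hence the
  -- interleaving is indexed by strict inequalities.
  obtain ⟨θ, hθ⟩ := IsColimit.exists_iso_of_lt hs ht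
    (fun i j hij => u (f i) ≫ Y.map (homOfLE (hφ i j hij)))
    (fun i j hij => v (f i) ≫ X.map (homOfLE (hψ i j hij)))
    (fun i j k hij hjk => (H i j k (hij.trans hjk) hjk).1 _ _ _)
    (fun i j k hij hjk => (Category.assoc (u (f i)) _ _).trans
      (congrArg (u (f i) ≫ ·) (Y.map_comp _ _).symm))
    (fun i j k hij hjk => (H i j k (hij.trans hjk) hjk).2.1 _ _ _)
    (fun i j k hij hjk => (Category.assoc (v (f i)) _ _).trans
      (congrArg (v (f i) ≫ ·) (X.map_comp _ _).symm))
    (fun i j k hij hjk => (Category.assoc (u (f i)) _ _).trans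
      ((H i j k (hij.trans hjk) hjk).2.2.1 _ _ _))
    (fun i j k hij hjk => (Category.assoc (v (f i)) _ _).trans
      ((H i j k (hij.trans hjk) hjk).2.2.2.1 _ _ _))
  refine ⟨θ, hs.hom_ext fun i => ?_, fun k i => ?_⟩
  · obtain ⟨j, hij⟩ := exists_gt i
    rw [reassoc_of% hθ i j hij, ht.fac, hs.fac_assoc]
    simpa using hu (f i)
  · obtain ⟨j, hij⟩ := exists_gt i
    rw [(hθ i j hij).trans (Category.assoc (u (f i)) _ _), ← t.w (homOfLE hij.le)]
    have := (H i i j hij hij).2.2.2.2.1 k (hpf i) (hφ i j hij) (hpf j)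
    rw [← homOfLE_comp (hpf i) (hf hij.le), Functor.map_comp] at this
    have h₃ {Z : E} (τ : Y.obj (f j) ⟶ Z) := by simpa using this =≫ τ
    exact h₃ (t.ι.app j)

end

/-! ### Sufficiently large stages of directed presentations -/

open Filter

section

variable {C : Type u₁} [Category.{v₁} C] {P : Type w} [PartialOrder P] {lam : Cardinal.{w}}
  [Fact lam.IsRegular] [IsCardinalFiltered P lam]

-- In a `lam`-directed poset, fewer than `lam` thresholds have a common upper bound.
variable (lam) in
lemma IsCardinalFiltered.eventually_forall {ι : Type*} (hι : HasCardinalLT ι lam)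
    {Q : ι → P → Prop} (hQ : ∀ k, ∀ᶠ p in atTop, Q k p) : ∀ᶠ p in atTop, ∀ k, Q k p := by
  have := isFiltered_of_isCardinalFiltered P lam
  have : IsDirectedOrder P := IsFiltered.isDirectedOrder P
  have : Nonempty P := IsFiltered.nonempty
  choose m hm using fun k => eventually_atTop.1 (hQ k)
  obtain ⟨n, hn⟩ := IsCardinalFiltered.exists_upperBound m hι
  filter_upwards [eventually_ge_atTop n] with p hp k
  exact hm k p ((hn k).trans hp)

variable {W : C} (x : ColimitPresentation P W)

variable (lam) in
lemma Limits.ColimitPresentation.eventually_exists_hom {A : C} [IsCardinalPresentable A lam]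
    (α : A ⟶ W) : ∀ᶠ p in atTop, ∃ a : A ⟶ x.diag.obj p, a ≫ x.ι.app p = α := by
  have := essentiallySmallSelf P
  obtain ⟨p, a, ha⟩ := IsCardinalPresentable.exists_hom_of_isColimit lam x.isColimit α
  filter_upwards [eventually_ge_atTop p] with q hq
  exact ⟨a ≫ x.diag.map (homOfLE hq), by simpa using ha⟩

variable (lam) in
lemma Limits.ColimitPresentation.eventually_eq {A : C} [IsCardinalPresentable A lam] {p : P}
    (α β : A ⟶ x.diag.obj p) (h : α ≫ x.ι.app p = β ≫ x.ι.app p) :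
    ∀ᶠ q in atTop, ∀ hq : p ≤ q,
      α ≫ x.diag.map (homOfLE hq) = β ≫ x.diag.map (homOfLE hq) := by
  filter_upwards [IsCardinalPresentable.eventually_eq lam x.isColimit α β h] with q hq h'
  exact hq h' h'

end

/-- Two objects of accessible categories are colimits of presentable objects indexed by
a common directed poset. -/
lemma exists_colimitPresentation_pair {C : Type u₁} [Category.{v₁} C] {D : Type u₂}
    [Category.{v₂} D] (lam : Cardinal.{w}) [Fact lam.IsRegular]
    [IsCardinalAccessibleCategory C lam] [IsCardinalAccessibleCategory D lam] (c : C) (d : D) :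
    ∃ (P : Type w) (_ : PartialOrder P) (_ : IsCardinalFiltered P lam)
      (x : ColimitPresentation P c) (y : ColimitPresentation P d),
      (∀ p, IsCardinalPresentable (x.diag.obj p) lam) ∧
      (∀ p, IsCardinalPresentable (y.diag.obj p) lam) := by
  obtain ⟨J₁, _, _, ⟨x⟩⟩ :=
    (isCardinalFilteredGenerator_isCardinalPresentable C lam).exists_colimitsOfShape c
  obtain ⟨J₂, _, _, ⟨y⟩⟩ :=
    (isCardinalFilteredGenerator_isCardinalPresentable D lam).exists_colimitsOfShape d
  have := isFiltered_of_isCardinalFiltered J₁ lam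
  have := isFiltered_of_isCardinalFiltered J₂ lam
  -- Both projections of the product of filtered categories are final, as is the functor `f` from a
  -- directed poset, so both presentations can be reindexed by `P`.
  obtain ⟨P, _, _, f, _⟩ := IsCardinalFiltered.exists_cardinal_directed (J₁ × J₂) lam
  exact ⟨P, inferInstance, inferInstance, x.toColimitPresentation.reindex (f ⋙ Prod.fst _ _),
    y.toColimitPresentation.reindex (f ⋙ Prod.snd _ _),
    fun p => x.prop_diag_obj _, fun p => y.prop_diag_obj _⟩

lemma hasCardinalLT_arrow_ord_toType {κ lam : Cardinal.{w}} [Fact lam.IsRegular] (h : κ < lam) :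
    HasCardinalLT (Arrow κ.ord.ToType) lam :=
  (hasCardinalLT_prod (Fact.out : lam.IsRegular).aleph0_le (hasCardinalLT_ord_toType h)
    (hasCardinalLT_ord_toType h)).of_injective (fun f => (f.left, f.right)) (by
      rintro ⟨a, b, f⟩ ⟨a', b', f'⟩ h
      obtain ⟨rfl, rfl⟩ := Prod.mk.inj h
      obtain rfl := Subsingleton.elim f f'
      rfl)

/-! ### Constructing objects over `W` with presentable components -/

namespace IsoComma

variable {C : Type u₁} [Category.{v₁} C] {D : Type u₂} [Category.{v₂} D]
  {E : Type u₃} [Category.{v₃} E] {F : C ⥤ E} {G : D ⥤ E}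
  {κ lam : Cardinal.{w}} [Fact κ.IsRegular] [Fact lam.IsRegular]

section

variable [HasCardinalFilteredColimits C κ] [HasCardinalFilteredColimits D κ]
  [F.IsCardinalAccessible κ] [G.IsCardinalAccessible κ]
  [LocallySmall.{w} C] [LocallySmall.{w} D]

/-- Given presentations of the components of an object `W` of the iso-comma category as
`lam`-directed colimits of presentable objects, any stage of these presentations maps to an
object over `W` with presentable components. -/
lemma exists_hom_of_colimitPresentation (h : κ < lam) {W : IsoComma F G}
    {P : Type w} [PartialOrder P] [IsCardinalFiltered P lam]
    (x : ColimitPresentation P W.obj.left) (y : ColimitPresentation P W.obj.right)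
    [∀ p, IsCardinalPresentable (x.diag.obj p) lam]
    [∀ p, IsCardinalPresentable (y.diag.obj p) lam]
    [∀ p, IsCardinalPresentable (F.obj (x.diag.obj p)) lam]
    [∀ p, IsCardinalPresentable (G.obj (y.diag.obj p)) lam]
    {ι : Type*} (hι : HasCardinalLT ι lam) {Z : ι → IsoComma F G}
    [∀ k, IsCardinalPresentable (F.obj (Z k).obj.left) lam] (z : ∀ k, Z k ⟶ W) {p : P}
    (a : ∀ k, (Z k).obj.left ⟶ x.diag.obj p) (b : ∀ k, (Z k).obj.right ⟶ y.diag.obj p)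
    (ha : ∀ k, a k ≫ x.ι.app p = (z k).hom.left) (hb : ∀ k, b k ≫ y.ι.app p = (z k).hom.right) :
    ∃ (V : IsoComma F G) (v : V ⟶ W) (a' : x.diag.obj p ⟶ V.obj.left)
      (b' : y.diag.obj p ⟶ V.obj.right),
      IsCardinalPresentable V.obj.left lam ∧ IsCardinalPresentable V.obj.right lam ∧
      a' ≫ v.hom.left = x.ι.app p ∧ b' ≫ v.hom.right = y.ι.app p ∧
      ∀ k, ∃ g : Z k ⟶ V, g ≫ v = z k ∧ g.hom.left = a k ≫ a' ∧ g.hom.right = b k ≫ b' := by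
  have := IsCardinalFiltered.of_le P h.le
  have := F.preservesColimitsOfShape_of_isCardinalAccessible κ P
  have := G.preservesColimitsOfShape_of_isCardinalAccessible κ P
  have := F.preservesColimitsOfShape_of_isCardinalAccessible κ κ.ord.ToType
  have := G.preservesColimitsOfShape_of_isCardinalAccessible κ κ.ord.ToType
  have := HasCardinalFilteredColimits.hasColimitsOfShape (κ := κ) C κ.ord.ToType
  have := HasCardinalFilteredColimits.hasColimitsOfShape (κ := κ) D κ.ord.ToType
  have (p : P) : IsCardinalPresentable ((x.diag ⋙ F).obj p) lam :=
    inferInstanceAs (IsCardinalPresentable (F.obj (x.diag.obj p)) lam)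
  have (p : P) : IsCardinalPresentable ((y.diag ⋙ G).obj p) lam :=
    inferInstanceAs (IsCardinalPresentable (G.obj (y.diag.obj p)) lam)
  -- The chain is chosen in `E`, for the images of the two presentations; the family `F.obj (Z
  -- k).obj.left` ensures that each `Z k` will map to the new object.
  obtain ⟨f, hf, H⟩ := IsCardinalPresentable.exists_chain_iso lam (κ := κ)
    (isColimitOfPreserves F x.isColimit) (isColimitOfPreserves G y.isColimit) h (iso W) hι
    (A := fun k => F.obj (Z k).obj.left) (p := p) (fun k => F.map (a k))
    (fun k => (Z k).obj.hom ≫ G.map (b k)) (fun k => by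
      have := (z k).hom.w
      dsimp at this ⊢
      rw [← Functor.map_comp_assoc, ha, this, Category.assoc, ← Functor.map_comp, hb])
  let cx : Cocone (f ⋙ x.diag) := colimit.cocone _
  let cy : Cocone (f ⋙ y.diag) := colimit.cocone _
  have hx : IsColimit cx := colimit.isColimit _
  have hy : IsColimit cy := colimit.isColimit _
  obtain ⟨θ, hθ₁, hθ₂⟩ := H (F.mapCocone cx) (isColimitOfPreserves F hx)
    (G.mapCocone cy) (isColimitOfPreserves G hy)
  let ex : cx.pt ⟶ W.obj.left := hx.desc ((Cocone.mk _ x.ι).whisker f)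
  let ey : cy.pt ⟶ W.obj.right := hy.desc ((Cocone.mk _ y.ι).whisker f)
  have hex (i) : cx.ι.app i ≫ ex = x.ι.app (f.obj i) := hx.fac _ i
  have hey (i) : cy.ι.app i ≫ ey = y.ι.app (f.obj i) := hy.fac _ i
  have hθ₃ : F.map ex ≫ W.obj.hom = θ.hom ≫ G.map ey := by
    refine Eq.trans ?_ (hθ₁.symm.trans ?_)
    · exact congrArg (· ≫ W.obj.hom) (preserves_desc_mapCocone F _ _ _ hx).symm
    · exact congrArg (θ.hom ≫ ·)
        (preserves_desc_mapCocone G _ _ ((Cocone.mk _ y.ι).whisker f) hy)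
  obtain ⟨i⟩ : Nonempty κ.ord.ToType := IsCardinalFiltered.nonempty _ κ
  let jx : x.diag.obj p ⟶ cx.pt := x.diag.map (homOfLE (hf i)) ≫ cx.ι.app i
  let jy : y.diag.obj p ⟶ cy.pt := y.diag.map (homOfLE (hf i)) ≫ cy.ι.app i
  have hjx : jx ≫ ex = x.ι.app p := (Category.assoc _ _ _).trans
    ((congrArg (x.diag.map (homOfLE (hf i)) ≫ ·) (hex i)).trans (by simp))
  have hjy : jy ≫ ey = y.ι.app p := (Category.assoc _ _ _).trans
    ((congrArg (y.diag.map (homOfLE (hf i)) ≫ ·) (hey i)).trans (by simp))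
  have hθ₄ (k) : F.map (a k ≫ jx) ≫ θ.hom = (Z k).obj.hom ≫ G.map (b k ≫ jy) := by
    have h₁ : F.map jx = F.map (x.diag.map (homOfLE (hf i))) ≫ F.map (cx.ι.app i) :=
      F.map_comp _ _
    have h₂ : G.map jy = G.map (y.diag.map (homOfLE (hf i))) ≫ G.map (cy.ι.app i) :=
      G.map_comp _ _
    have h₃ := hθ₂ k i
    rw [Category.assoc] at h₃
    rw [F.map_comp (a k) jx, G.map_comp (b k) jy, h₁, h₂, Category.assoc, Category.assoc]
    exact h₃
  refine ⟨mk θ, homMk ex ey hθ₃, jx, jy, ?_, ?_, hjx, hjy, fun k =>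
    ⟨homMk (a k ≫ jx) (b k ≫ jy) (hθ₄ k), ?_, rfl, rfl⟩⟩
  -- Here `κ < lam` is essential: the chain has fewer than `lam` arrows, so its colimit stays
  -- presentable.
  · have (j : κ.ord.ToType) : IsCardinalPresentable ((f ⋙ x.diag).obj j) lam :=
      inferInstanceAs (IsCardinalPresentable (x.diag.obj (f.obj j)) lam)
    exact isCardinalPresentable_of_isColimit _ hx lam (hasCardinalLT_arrow_ord_toType h)
  · have (j : κ.ord.ToType) : IsCardinalPresentable ((f ⋙ y.diag).obj j) lam :=
      inferInstanceAs (IsCardinalPresentable (y.diag.obj (f.obj j)) lam)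
    exact isCardinalPresentable_of_isColimit _ hy lam (hasCardinalLT_arrow_ord_toType h)
  · ext
    · exact (Category.assoc _ _ _).trans ((congrArg (a k ≫ ·) hjx).trans (ha k))
    · exact (Category.assoc _ _ _).trans ((congrArg (b k ≫ ·) hjy).trans (hb k))

end

end IsoComma

/-- Constructor for objects of the category of objects satisfying `P` over a given object. -/
abbrev ObjectProperty.costructuredArrowMk {C : Type u₁} [Category.{v₁} C] (P : ObjectProperty C)
    {X Y : C} (hX : P X) (f : X ⟶ Y) : CostructuredArrow P.ι Y :=
  CostructuredArrow.mk (S := P.ι) (Y := (ObjectProperty.FullSubcategory.mk X hX)) f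

/-! ### The generator and accessibility -/

namespace IsoComma

variable {C : Type u₁} [Category.{v₁} C] {D : Type u₂} [Category.{v₂} D]
  {E : Type u₃} [Category.{v₃} E] {F : C ⥤ E} {G : D ⥤ E}
  {κ lam : Cardinal.{w}} [Fact κ.IsRegular] [Fact lam.IsRegular]

variable (F G lam) in
/-- The objects of the iso-comma category whose components are presentable. -/
def componentsPresentable : ObjectProperty (IsoComma F G) := fun X =>
  IsCardinalPresentable X.obj.left lam ∧ IsCardinalPresentable X.obj.right lam

instance [LocallySmall.{w} C] [LocallySmall.{w} D] : LocallySmall.{w} (IsoComma F G) where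
  hom_small X Y := small_of_injective
    (β := (X.obj.left ⟶ Y.obj.left) × (X.obj.right ⟶ Y.obj.right))
    (f := fun f => (f.hom.left, f.hom.right))
    (fun _ _ h => hom_ext (Prod.ext_iff.1 h).1 (Prod.ext_iff.1 h).2)

instance (c d : C) [LocallySmall.{w} C] : Small.{w} (c ≅ d) :=
  small_of_injective (f := fun e : c ≅ d => e.hom) (fun _ _ h => Iso.ext h)

/-- There are essentially few objects with components in given essentially small classes. -/
lemma essentiallySmall_of_components [LocallySmall.{w} E] (P : ObjectProperty C)
    (Q : ObjectProperty D) [ObjectProperty.EssentiallySmall.{w} P]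
    [ObjectProperty.EssentiallySmall.{w} Q] :
    ObjectProperty.EssentiallySmall.{w}
      (fun X : IsoComma F G => P X.obj.left ∧ Q X.obj.right) where
  exists_small_le' := by
    obtain ⟨P', _, -, hP⟩ := ObjectProperty.EssentiallySmall.exists_small_le.{w} P
    obtain ⟨Q', _, -, hQ⟩ := ObjectProperty.EssentiallySmall.exists_small_le.{w} Q
    -- `T` is small because `E` is locally small. Transporting the structure isomorphism to
    -- representatives of the components shows that `T` meets every isomorphism class.
    let T := Σ (c : Subtype P') (d : Subtype Q'), (F.obj c.1 ≅ G.obj d.1)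
    refine ⟨ObjectProperty.ofObj (fun t : T => mk t.2.2), inferInstance, fun X hX => ?_⟩
    obtain ⟨c, hc, ⟨i⟩⟩ := hP _ hX.1
    obtain ⟨d, hd, ⟨j⟩⟩ := hQ _ hX.2
    have hw : F.map i.hom ≫ F.map i.inv ≫ X.obj.hom ≫ G.map j.hom = X.obj.hom ≫ G.map j.hom := by
      simp
    refine ⟨_, ⟨(⟨⟨c, hc⟩, ⟨d, hd⟩, F.mapIso i.symm ≪≫ iso X ≪≫ G.mapIso j⟩ : T)⟩,
      ⟨isoMk i j hw⟩⟩

variable (W : IsoComma F G)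

/-- The first component of the objects over `W` with presentable components. -/
def costructuredArrowFst : CostructuredArrow (componentsPresentable F G lam).ι W ⥤
    CostructuredArrow (CategoryTheory.isCardinalPresentable C lam).ι W.obj.left where
  obj q := (CategoryTheory.isCardinalPresentable C lam).costructuredArrowMk q.left.property.1 q.hom.hom.left
  map f := CostructuredArrow.homMk (ObjectProperty.homMk f.left.hom.hom.left)
    (congrArg (fun f => f.hom.left) (CostructuredArrow.w f))

/-- The second component of the objects over `W` with presentable components. -/
def costructuredArrowSnd : CostructuredArrow (componentsPresentable F G lam).ι W ⥤
    CostructuredArrow (CategoryTheory.isCardinalPresentable D lam).ι W.obj.right where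
  obj q := (CategoryTheory.isCardinalPresentable D lam).costructuredArrowMk q.left.property.2 q.hom.hom.right
  map f := CostructuredArrow.homMk (ObjectProperty.homMk f.left.hom.hom.right)
    (congrArg (fun f => f.hom.right) (CostructuredArrow.w f))

section

variable (κ) [HasCardinalFilteredColimits C κ] [HasCardinalFilteredColimits D κ]
  [F.IsCardinalAccessible κ] [G.IsCardinalAccessible κ] (h : κ < lam)
  (hF : F.IsStronglyCardinalAccessible lam) (hG : G.IsStronglyCardinalAccessible lam)

include h hF hG

/-- A small family of maps to `W` from objects with presentable components factors through
a single such object; moreover, this object can be chosen so that it coequalizes given families of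
morphisms to one of the sources which are coequalized in `W`, and so that given
maps from presentable objects to the components of `W` factor through it. -/
lemma exists_hom_of_family {ι : Type*} (hι : HasCardinalLT ι lam)
    {Z : ι → IsoComma F G} (hZ : ∀ k, componentsPresentable F G lam (Z k)) (z : ∀ k, Z k ⟶ W)
    {ι' : Type*} (hι' : HasCardinalLT ι' lam)
    {A : ι → ι' → C} (hA : ∀ k i, IsCardinalPresentable (A k i) lam)
    (s t : ∀ k i, A k i ⟶ (Z k).obj.left)
    (hst : ∀ k i, s k i ≫ (z k).hom.left = t k i ≫ (z k).hom.left)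
    {B : ι → ι' → D} (hB : ∀ k i, IsCardinalPresentable (B k i) lam)
    (s' t' : ∀ k i, B k i ⟶ (Z k).obj.right)
    (hst' : ∀ k i, s' k i ≫ (z k).hom.right = t' k i ≫ (z k).hom.right)
    {A₀ : ι → C} (hA₀ : ∀ k, IsCardinalPresentable (A₀ k) lam) (α : ∀ k, A₀ k ⟶ W.obj.left)
    {B₀ : ι → D} (hB₀ : ∀ k, IsCardinalPresentable (B₀ k) lam) (β : ∀ k, B₀ k ⟶ W.obj.right) :
    ∃ (V : IsoComma F G) (v : V ⟶ W) (g : ∀ k, Z k ⟶ V),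
      componentsPresentable F G lam V ∧ (∀ k, g k ≫ v = z k) ∧
      (∀ k i, s k i ≫ (g k).hom.left = t k i ≫ (g k).hom.left) ∧
      (∀ k i, s' k i ≫ (g k).hom.right = t' k i ≫ (g k).hom.right) ∧
      (∀ k, ∃ α' : A₀ k ⟶ V.obj.left, α' ≫ v.hom.left = α k) ∧
      (∀ k, ∃ β' : B₀ k ⟶ V.obj.right, β' ≫ v.hom.right = β k) := by
  have := hF.source_accessible
  have := hG.source_accessible
  obtain ⟨P, _, _, x, y, hx, hy⟩ :=
    exists_colimitPresentation_pair lam W.obj.left W.obj.right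
  have := isFiltered_of_isCardinalFiltered P lam
  have : IsDirectedOrder P := IsFiltered.isDirectedOrder P
  have : Nonempty P := IsFiltered.nonempty
  have (k : ι) : IsCardinalPresentable (Z k).obj.left lam := (hZ k).1
  have (k : ι) : IsCardinalPresentable (Z k).obj.right lam := (hZ k).2
  have (k : ι) : IsCardinalPresentable (F.obj (Z k).obj.left) lam := hF.preserves_presentable _ (hZ k).1
  have (p : P) := hF.preserves_presentable _ (hx p)
  have (p : P) := hG.preserves_presentable _ (hy p)
  -- At stage `p` the components of all `z k` factor. A later stage `q` realizes the coequalizing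
  -- conditions and the factorizations of `α` and `β`; the new object is built over `q`.
  obtain ⟨p, hp⟩ := ((IsCardinalFiltered.eventually_forall lam hι
      (fun k => x.eventually_exists_hom lam (z k).hom.left)).and
    (IsCardinalFiltered.eventually_forall lam hι
      (fun k => y.eventually_exists_hom lam (z k).hom.right))).exists
  choose a ha using hp.1
  choose b hb using hp.2
  obtain ⟨q, hpq, hqx, hqy, hα, hβ⟩ := ((eventually_ge_atTop p).and
    ((IsCardinalFiltered.eventually_forall lam hι (fun k =>
      IsCardinalFiltered.eventually_forall lam hι' (fun i =>
      x.eventually_eq lam (s k i ≫ a k) (t k i ≫ a k) (by simp [ha, hst])))).and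
    ((IsCardinalFiltered.eventually_forall lam hι (fun k =>
      IsCardinalFiltered.eventually_forall lam hι' (fun i =>
      y.eventually_eq lam (s' k i ≫ b k) (t' k i ≫ b k) (by simp [hb, hst'])))).and
    ((IsCardinalFiltered.eventually_forall lam hι
      (fun k => x.eventually_exists_hom lam (α k))).and
    (IsCardinalFiltered.eventually_forall lam hι
      (fun k => y.eventually_exists_hom lam (β k))))))).exists
  obtain ⟨V, v, a', b', hV₁, hV₂, ha', hb', H⟩ := exists_hom_of_colimitPresentation h x y hι z
    (fun k => a k ≫ x.diag.map (homOfLE hpq)) (fun k => b k ≫ y.diag.map (homOfLE hpq))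
    (by simpa using ha) (by simpa using hb)
  choose α' hα using hα
  choose β' hβ using hβ
  choose g hg hg₁ hg₂ using H
  refine ⟨V, v, g, ⟨hV₁, hV₂⟩, hg, fun k i => ?_, fun k i => ?_,
    fun k => ⟨α' k ≫ a', by simp [ha', hα]⟩, fun k => ⟨β' k ≫ b', by simp [hb', hβ]⟩⟩
  · have := hqx k i hpq =≫ a'
    simpa [hg₁] using this
  · have := hqy k i hpq =≫ b'
    simpa [hg₂] using this

/-- Upper bounds of objects come from factoring a family through one object, and coequalizers of
parallel arrows from the coequalizing clauses of `exists_hom_of_family`. -/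
lemma isCardinalFiltered_costructuredArrow :
    IsCardinalFiltered (CostructuredArrow (componentsPresentable F G lam).ι W) lam := by
  have hlam : Cardinal.aleph0 ≤ lam := (Fact.out : lam.IsRegular).aleph0_le
  have H ⦃ι : Type w⦄ (q : ι → CostructuredArrow (componentsPresentable F G lam).ι W)
      (hι : HasCardinalLT ι lam) :
      ∃ (r : CostructuredArrow (componentsPresentable F G lam).ι W),
        ∀ i, Nonempty (q i ⟶ r) := by
    have hq (i : ι) := (q i).left.property
    -- Only the common factorization matters; identities and known components fill the other slots.
    obtain ⟨V, v, g, hV, hg, -⟩ := exists_hom_of_family κ W h hF hG hι hq (fun i => (q i).hom)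
      (hasCardinalLT_of_finite PUnit.{1} _ hlam)
      (fun i _ => (hq i).1) (fun i _ => 𝟙 _) (fun i _ => 𝟙 _) (fun _ _ => rfl)
      (fun i _ => (hq i).2) (fun i _ => 𝟙 _) (fun i _ => 𝟙 _) (fun _ _ => rfl)
      (fun i => (hq i).1) (fun i => (q i).hom.hom.left)
      (fun i => (hq i).2) (fun i => (q i).hom.hom.right)
    exact ⟨(componentsPresentable F G lam).costructuredArrowMk hV v,
      fun i => ⟨CostructuredArrow.homMk (ObjectProperty.homMk (g i)) (hg i)⟩⟩
  rw [isCardinalFiltered_iff]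
  refine ⟨H, fun ι q r f hι => ?_⟩
  -- With a base index `i₀`, it is enough to coequalize each `f i` with `f i₀`. For an empty family
  -- any upper bound of `q` and `r` will do.
  by_cases hι₀ : Nonempty ι
  · let i₀ : ι := Classical.arbitrary ι
    have hq := q.left.property
    have hr := r.left.property
    have hf (i : ι) : (f i).left.hom ≫ r.hom = (f i₀).left.hom ≫ r.hom :=
      (CostructuredArrow.w (f i)).trans (CostructuredArrow.w (f i₀)).symm
    obtain ⟨V, v, g, hV, hg, hg₁, hg₂, -⟩ := exists_hom_of_family κ W h hF hG
      (hasCardinalLT_of_finite PUnit.{1} _ hlam) (fun _ => hr) (fun _ => r.hom) hι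
      (fun _ _ => hq.1) (fun _ i => (f i).left.hom.hom.left) (fun _ i => (f i₀).left.hom.hom.left)
      (fun _ i => congrArg (fun f => f.hom.left) (hf i))
      (fun _ _ => hq.2) (fun _ i => (f i).left.hom.hom.right)
      (fun _ i => (f i₀).left.hom.hom.right)
      (fun _ i => congrArg (fun f => f.hom.right) (hf i))
      (fun _ => hr.1) (fun _ => r.hom.hom.left) (fun _ => hr.2) (fun _ => r.hom.hom.right)
    let a : r ⟶ (componentsPresentable F G lam).costructuredArrowMk hV v := CostructuredArrow.homMk (ObjectProperty.homMk (g ⟨⟩)) (hg ⟨⟩)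
    refine ⟨_, a, f i₀ ≫ a, fun i => CostructuredArrow.hom_ext _ _
      (ObjectProperty.hom_ext _ (hom_ext (hg₁ ⟨⟩ i) (hg₂ ⟨⟩ i)))⟩
  · obtain ⟨l, hl⟩ := H (fun b : ULift.{w} Bool => if b.down then q else r)
      (hasCardinalLT_of_finite _ _ hlam)
    exact ⟨l, (hl ⟨false⟩).some, (hl ⟨true⟩).some, fun i => (hι₀ ⟨i⟩).elim⟩

/-- As the source is filtered, finality reduces to two conditions: each presentable object over the
left component of `W` maps to one in the image, and parallel maps into the image become equal
further on. These are the `α` and `s`, `t` clauses of `exists_hom_of_family`. -/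
lemma final_costructuredArrowFst : (costructuredArrowFst (lam := lam) W).Final := by
  have := isCardinalFiltered_costructuredArrow κ W h hF hG
  have := isFiltered_of_isCardinalFiltered (CostructuredArrow (componentsPresentable F G lam).ι W)
    lam
  have hfin := hasCardinalLT_of_finite PUnit.{1} _ (Fact.out : lam.IsRegular).aleph0_le
  refine Functor.final_of_exists_of_isFiltered _ (fun A => ?_) (fun {A q} s t => ?_)
  · obtain ⟨q⟩ : Nonempty (CostructuredArrow (componentsPresentable F G lam).ι W) :=
      IsFiltered.nonempty
    have hq := q.left.property
    obtain ⟨V, v, g, hV, -, -, -, hα, -⟩ := exists_hom_of_family κ W h hF hG hfin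
      (fun _ => hq) (fun _ => q.hom) hfin
      (fun _ _ => hq.1) (fun _ _ => 𝟙 _) (fun _ _ => 𝟙 _) (fun _ _ => rfl)
      (fun _ _ => hq.2) (fun _ _ => 𝟙 _) (fun _ _ => 𝟙 _) (fun _ _ => rfl)
      (fun _ => A.left.property) (fun _ => A.hom) (fun _ => hq.2) (fun _ => q.hom.hom.right)
    obtain ⟨α, hα⟩ := hα ⟨⟩
    exact ⟨(componentsPresentable F G lam).costructuredArrowMk hV v,
      ⟨CostructuredArrow.homMk (ObjectProperty.homMk α) hα⟩⟩
  · have hq := q.left.property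
    obtain ⟨V, v, g, hV, hg, hst, -⟩ := exists_hom_of_family κ W h hF hG hfin
      (fun _ => hq) (fun _ => q.hom) hfin
      (fun _ _ => A.left.property) (fun _ _ => s.left.hom) (fun _ _ => t.left.hom)
      (fun _ _ => (CostructuredArrow.w s).trans (CostructuredArrow.w t).symm)
      (fun _ _ => hq.2) (fun _ _ => 𝟙 _) (fun _ _ => 𝟙 _) (fun _ _ => rfl)
      (fun _ => hq.1) (fun _ => q.hom.hom.left) (fun _ => hq.2) (fun _ => q.hom.hom.right)
    exact ⟨(componentsPresentable F G lam).costructuredArrowMk hV v,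
      CostructuredArrow.homMk (ObjectProperty.homMk (g ⟨⟩)) (hg ⟨⟩),
      CostructuredArrow.hom_ext _ _ (ObjectProperty.hom_ext _ (hst ⟨⟩ ⟨⟩))⟩

lemma final_costructuredArrowSnd : (costructuredArrowSnd (lam := lam) W).Final := by
  have := isCardinalFiltered_costructuredArrow κ W h hF hG
  have := isFiltered_of_isCardinalFiltered (CostructuredArrow (componentsPresentable F G lam).ι W)
    lam
  have hfin := hasCardinalLT_of_finite PUnit.{1} _ (Fact.out : lam.IsRegular).aleph0_le
  refine Functor.final_of_exists_of_isFiltered _ (fun B => ?_) (fun {B q} s t => ?_)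
  · obtain ⟨q⟩ : Nonempty (CostructuredArrow (componentsPresentable F G lam).ι W) :=
      IsFiltered.nonempty
    have hq := q.left.property
    obtain ⟨V, v, g, hV, -, -, -, -, hβ⟩ := exists_hom_of_family κ W h hF hG hfin
      (fun _ => hq) (fun _ => q.hom) hfin
      (fun _ _ => hq.1) (fun _ _ => 𝟙 _) (fun _ _ => 𝟙 _) (fun _ _ => rfl)
      (fun _ _ => hq.2) (fun _ _ => 𝟙 _) (fun _ _ => 𝟙 _) (fun _ _ => rfl)
      (fun _ => hq.1) (fun _ => q.hom.hom.left) (fun _ => B.left.property) (fun _ => B.hom)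
    obtain ⟨β, hβ⟩ := hβ ⟨⟩
    exact ⟨(componentsPresentable F G lam).costructuredArrowMk hV v,
      ⟨CostructuredArrow.homMk (ObjectProperty.homMk β) hβ⟩⟩
  · have hq := q.left.property
    obtain ⟨V, v, g, hV, hg, -, hst, -⟩ := exists_hom_of_family κ W h hF hG hfin
      (fun _ => hq) (fun _ => q.hom) hfin
      (fun _ _ => hq.1) (fun _ _ => 𝟙 _) (fun _ _ => 𝟙 _) (fun _ _ => rfl)
      (fun _ _ => B.left.property) (fun _ _ => s.left.hom) (fun _ _ => t.left.hom)
      (fun _ _ => (CostructuredArrow.w s).trans (CostructuredArrow.w t).symm)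
      (fun _ => hq.1) (fun _ => q.hom.hom.left) (fun _ => hq.2) (fun _ => q.hom.hom.right)
    exact ⟨(componentsPresentable F G lam).costructuredArrowMk hV v,
      CostructuredArrow.homMk (ObjectProperty.homMk (g ⟨⟩)) (hg ⟨⟩),
      CostructuredArrow.hom_ext _ _ (ObjectProperty.hom_ext _ (hst ⟨⟩ ⟨⟩))⟩

/-- The objects with presentable components form a generator of the iso-comma category. -/
lemma isCardinalFilteredGenerator :
    (componentsPresentable F G lam).IsCardinalFilteredGenerator lam where
  le_isCardinalPresentable X hX := by
    have := hX.1
    have := hX.2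
    have := hF.preserves_presentable _ hX.1
    exact isCardinalPresentable κ h.le X
  exists_colimitsOfShape W := by
    have := hF.source_accessible
    have := hG.source_accessible
    have := hF.target_accessible
    have : ObjectProperty.EssentiallySmall.{w} (componentsPresentable F G lam) :=
      essentiallySmall_of_components (CategoryTheory.isCardinalPresentable C lam)
        (CategoryTheory.isCardinalPresentable D lam)
    let Q := CostructuredArrow (componentsPresentable F G lam).ι W
    have : IsCardinalFiltered Q lam := isCardinalFiltered_costructuredArrow κ W h hF hG
    have := final_costructuredArrowFst κ W h hF hG
    have := final_costructuredArrowSnd κ W h hF hG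
    have : IsCardinalFiltered Q κ := IsCardinalFiltered.of_le Q h.le
    have :=
      F.preservesColimitsOfShape_of_isCardinalAccessible_of_essentiallySmall κ Q
    let p : (componentsPresentable F G lam).ColimitOfShape Q W :=
      { diag := CostructuredArrow.proj _ _ ⋙ (componentsPresentable F G lam).ι
        ι :=
          { app q := q.hom
            naturality _ _ f := (CostructuredArrow.w f).trans (Category.comp_id _).symm }
        -- On each component the cocone is the canonical cocone of presentable objects, colimiting
        -- by density, restricted along a final functor. `F` preserves the colimit since `Q` is
        -- `κ`-filtered.
        isColimit := isColimitOfFstSnd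
          (IsColimit.ofIsoColimit
            ((Functor.Final.isColimitWhiskerEquiv (costructuredArrowFst (lam := lam) W) _).symm
              ((CategoryTheory.isCardinalPresentable C lam).ι.denseAt W.obj.left))
            (Cocone.ext (Iso.refl _) (fun q => (Category.comp_id _).trans (Category.id_comp _))))
          (IsColimit.ofIsoColimit
            ((Functor.Final.isColimitWhiskerEquiv (costructuredArrowSnd (lam := lam) W) _).symm
              ((CategoryTheory.isCardinalPresentable D lam).ι.denseAt W.obj.right))
            (Cocone.ext (Iso.refl _) (fun q => (Category.comp_id _).trans (Category.id_comp _))))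
        prop_diag_obj q := q.left.property }
    -- `Q` is only essentially small, so the presentation is moved to a small model.
    exact ⟨SmallModel.{w} Q, inferInstance,
      IsCardinalFiltered.of_equivalence lam (equivSmallModel.{w} Q),
      ⟨p.reindex (equivSmallModel.{w} Q).inverse⟩⟩

lemma isCardinalAccessibleCategory : IsCardinalAccessibleCategory (IsoComma F G) lam := by
  have := hF.source_accessible
  have := hG.source_accessible
  have := hF.target_accessible
  have : ObjectProperty.EssentiallySmall.{w} (componentsPresentable F G lam) :=
    essentiallySmall_of_components (CategoryTheory.isCardinalPresentable C lam)
      (CategoryTheory.isCardinalPresentable D lam)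
  have := (isCardinalFilteredGenerator κ h hF hG).hasCardinalFilteredGenerator
  have := F.isCardinalAccessible_of_le h.le
  have := G.isCardinalAccessible_of_le h.le
  have := hasCardinalFilteredColimits F G lam
  constructor

/-- A presentable object is a retract of a member of the generator; the projections preserve
retracts, and retracts of presentable objects are presentable. -/
lemma componentsPresentable_of_isCardinalPresentable (X : IsoComma F G)
    (hX : IsCardinalPresentable X lam) :
    IsCardinalPresentable X.obj.left lam ∧ IsCardinalPresentable X.obj.right lam := by
  rw [← isCardinalPresentable_iff,
    (isCardinalFilteredGenerator κ h hF hG).isPresentable_eq_retractClosure] at hX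
  obtain ⟨Y, hY, ⟨r⟩⟩ := hX
  have : IsCardinalPresentable ((fst F G).obj Y) lam := hY.1
  have : IsCardinalPresentable ((snd F G).obj Y) lam := hY.2
  exact ⟨(r.map (fst F G)).isCardinalPresentable lam, (r.map (snd F G)).isCardinalPresentable lam⟩

lemma isStronglyCardinalAccessible_fst :
    (fst F G).IsStronglyCardinalAccessible lam where
  source_accessible := isCardinalAccessibleCategory κ h hF hG
  target_accessible := hF.source_accessible
  preserves_colimits :=
    have := isCardinalAccessible_fst (F := F) (G := G) κ
    Functor.isCardinalAccessible_of_le _ h.le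
  preserves_presentable X hX := (componentsPresentable_of_isCardinalPresentable κ h hF hG X hX).1

lemma isStronglyCardinalAccessible_snd :
    (snd F G).IsStronglyCardinalAccessible lam where
  source_accessible := isCardinalAccessibleCategory κ h hF hG
  target_accessible := hG.source_accessible
  preserves_colimits :=
    have := isCardinalAccessible_snd (F := F) (G := G) κ
    Functor.isCardinalAccessible_of_le _ h.le
  preserves_presentable X hX := (componentsPresentable_of_isCardinalPresentable κ h hF hG X hX).2

end

end IsoComma

end CategoryTheory

theorem mainTheorem6
    {C : Type u₁} [Category.{v₁} C] {D : Type u₂} [Category.{v₂} D]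
    {E : Type u₃} [Category.{v₃} E]
    (κ lam : Cardinal.{w}) [Fact κ.IsRegular] [Fact lam.IsRegular]
    [HasCardinalFilteredColimits C κ] [HasCardinalFilteredColimits D κ]
    [HasCardinalFilteredColimits E κ]
    (F : C ⥤ E) (G : D ⥤ E) [F.IsCardinalAccessible κ] [G.IsCardinalAccessible κ] :
    (HasCardinalFilteredColimits (IsoComma F G) κ ∧
      ∀ (J : Type w) [SmallCategory J] [IsCardinalFiltered J κ],
        Nonempty (CreatesColimitsOfShape J (IsoComma.proj F G))) ∧
    (κ ≤ lam → ∀ X : IsoComma F G,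
      IsCardinalPresentable X.obj.left lam →
      IsCardinalPresentable X.obj.right lam →
      IsCardinalPresentable (F.obj X.obj.left) lam →
      IsCardinalPresentable X lam) ∧
    (κ < lam → F.IsStronglyCardinalAccessible lam → G.IsStronglyCardinalAccessible lam →
      IsCardinalAccessibleCategory (IsoComma F G) lam ∧
      (IsoComma.fst F G).IsStronglyCardinalAccessible lam ∧
      (IsoComma.snd F G).IsStronglyCardinalAccessible lam) := by
  refine ⟨⟨IsoComma.hasCardinalFilteredColimits F G κ, fun J _ _ =>
    ⟨IsoComma.createsColimitsOfShapeProj F G κ J⟩⟩, fun h X _ _ _ =>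
    IsoComma.isCardinalPresentable κ h X, fun h hF hG => ⟨?_, ?_, ?_⟩⟩
  · exact IsoComma.isCardinalAccessibleCategory κ h hF hG
  · exact IsoComma.isStronglyCardinalAccessible_fst κ h hF hG
  · exact IsoComma.isStronglyCardinalAccessible_snd κ h hF hG
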